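/- For an integer $d\ge 0$ let $\Delta$ be a $(d-1)$-dimensional simplicial complex on a finite ground set, i.e. a set of subsets ("faces") that is closed under taking subsets, contains $\emptyset$, and whose largest faces have $d$ elements. Let $f_{k-1}^\Delta$ be the number of faces with $k$ elements; the $h$-vector $h^\Delta=(h_0^\Delta,\dots,h_d^\Delta)$ is defined by $\sum_{i=0}^d h_i^\Delta x^{d-i}=\sum_{i=0}^d f_{i-1}^\Delta (x-1)^{d-i}$. The barycentric subdivision $\mathrm{sd}\,\Delta$ is the simplicial complex whose faces are the sets of nonempty faces of $\Delta$ that are totally ordered by inclusion. **Theorem.** For every $d\ge 0$ there is exactly one real matrix $H_{\mathcal F}=(h_{ij})_{0\le i,j\le d}$ such that $$h^{\mathrm{sd}\,\Delta}=H_{\mathcal F}\,h^{\Delta}$$ for all $(d-1)$-dimensional simplicial complexes $\Delta$. Its entries are $h_{ij}=A(d+1,i,j)$, where, for $n \geq 1$ and $0\le i,j\le n-1$, $A(n,i,j)$ is the number of permutations $\sigma$ of $\{1,\dots,n\}$ with exactly $i$ descents (positions $k\in\{1,\dots,n-1\}$ with $\sigma(k)>\sigma(k+1)$) and last letter $\sigma(n)=n-j$.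 The matrix $H_{\mathcal F}$ is TP$_2$: all its entries and all its $2\times 2$ minors are non-negative. -/

import Mathlib

open Polynomial

/-- A matrix is `TP_r` if for `1 ≤ k ≤ r` all its `k × k` minors (rows and columns taken in
increasing order) are non-negative. In particular (`k = 1`) all entries are non-negative. -/
def Matrix.IsTP {m n : Type*} [Preorder m] [Preorder n] (r : ℕ) (M : Matrix m n ℝ) : Prop :=
  ∀ k : ℕ, 1 ≤ k → k ≤ r → ∀ (rows : Fin k ↪o m) (cols : Fin k ↪o n),
    0 ≤ (M.submatrix rows cols).det

/-! ### Permutations by number of descents and last letter -/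

/-- The set of descents of a permutation `σ`: positions `k` which are not the last one
and satisfy `σ k > σ (k + 1)`. -/
def descentSet {d : ℕ} (σ : Equiv.Perm (Fin d)) : Finset (Fin d) :=
  {k | ∃ l : Fin d, (l : ℕ) = k + 1 ∧ σ l < σ k}

/-- `A(d, i, j)`: the number of permutations of `[d]` with exactly `i` descents and last letter
`d - j`. Letters and positions are `0, …, d - 1` here, so the last letter `d - j` in the usual
numbering `1, …, d` is the element `d - j - 1` of `Fin d`. -/
def refinedEulerian (d i j : ℕ) : ℕ :=
  Fintype.card {σ : Equiv.Perm (Fin d) //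
    (descentSet σ).card = i ∧ ∃ l : Fin d, (l : ℕ) + 1 = d ∧ (σ l : ℕ) + 1 + j = d}

/-! ### Simplicial complexes, `h`-vectors and barycentric subdivision

Mathlib's `PreAbstractSimplicialComplex` records the nonempty faces only; the empty face,
of dimension `-1`, is added where faces are counted. -/

namespace PreAbstractSimplicialComplex

variable {V : Type*}

/-- All faces of `Δ`, including the empty one. -/
def allFaces (Δ : PreAbstractSimplicialComplex V) : Set (Finset V) :=
  insert ∅ Δ.faces

/-- `Δ` has dimension `d - 1`, i.e. the maximal cardinality of a face is `d`. -/
def HasDimPred (Δ : PreAbstractSimplicialComplex V) (d : ℕ) : Prop :=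
  IsGreatest (Finset.card '' Δ.allFaces) d

/-- The number `f_{k-1}` of faces of cardinality `k`, i.e. of dimension `k - 1`. -/
noncomputable def faceNumber (Δ : PreAbstractSimplicialComplex V) (k : ℕ) : ℕ :=
  {s ∈ Δ.allFaces | s.card = k}.ncard

/-- The `f`-polynomial `∑ i ≤ d, f_{i-1} x^{d-i}` of a complex `Δ` of dimension `d - 1`. -/
noncomputable def fPoly (d : ℕ) (Δ : PreAbstractSimplicialComplex V) : ℝ[X] :=
  ∑ i ∈ Finset.range (d + 1), C (Δ.faceNumber i : ℝ) * X ^ (d - i)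

/-- The `h`-polynomial `h(x) = f(x - 1)` of a complex `Δ` of dimension `d - 1`. -/
noncomputable def hPoly (d : ℕ) (Δ : PreAbstractSimplicialComplex V) : ℝ[X] :=
  (Δ.fPoly d).comp (X - 1)

/-- The `h`-vector `(h_0, …, h_d)` of a complex `Δ` of dimension `d - 1`, where
`h(x) = ∑ i ≤ d, h_i x^{d-i}`. -/
noncomputable def hVector (d : ℕ) (Δ : PreAbstractSimplicialComplex V) : Fin (d + 1) → ℝ :=
  fun i => (Δ.hPoly d).coeff (d - i)

/-- The barycentric subdivision of `Δ`: its vertices are the nonempty faces of `Δ` and its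
faces are the chains of nonempty faces of `Δ`, ordered by inclusion. -/
def barycentricSubdivision (Δ : PreAbstractSimplicialComplex V) :
    PreAbstractSimplicialComplex (Finset V) where
  faces := {c | c.Nonempty ∧ (c : Set (Finset V)) ⊆ Δ.faces ∧
    IsChain (· ⊆ ·) (c : Set (Finset V))}
  isRelLowerSet_faces := by
    rintro c ⟨hne, hsub, hchain⟩
    refine ⟨hne, fun b hb hbne => ⟨hbne, ?_, ?_⟩⟩
    · exact (Finset.coe_subset.mpr hb).trans hsub
    · exact hchain.mono (Finset.coe_subset.mpr hb)

end PreAbstractSimplicialComplex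

/-- `H` is an `h`-vector transformation matrix of barycentric subdivision in dimension `d - 1`:
`h(sd Δ) = H h(Δ)` for every simplicial complex `Δ` of dimension `d - 1` on a finite ground
set. -/
def IsBarycentricHMatrix (d : ℕ) (H : Matrix (Fin (d + 1)) (Fin (d + 1)) ℝ) : Prop :=
  ∀ (V : Type) [Finite V] (Δ : PreAbstractSimplicialComplex V), Δ.HasDimPred d →
    Δ.barycentricSubdivision.hVector d = H.mulVec (Δ.hVector d)

/-! Deleting the last letter of a permutation and standardizing gives `refinedEulerian_succ`:
A(n+2,i,j) is the sum of A(n+1,i-1,l) over l < j and of A(n+1,i,l) over l ≥ j. Both existence and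
positivity follow from this recursion.

Positivity: continue the matrix to infinitely many columns, a shift by one full period of columns
being a shift by one row. The recursion then says that each new column is the sum of a window of
consecutive old columns, and that the window moves weakly to the right. Such window sums preserve
non-negativity of 2×2 minors (`sum_window_mul_sum_window_le`), and the induction starts from an
identity matrix.

Existence: grouping chains by their largest member expresses the h-polynomial of sd Δ through the
face numbers of Δ, hence through its h-vector. The column polynomials obtained (`subdivisionPoly`)
and those of A(d+1,i,j) (`eulerianPoly`) satisfy the same recursions, so they agree.

Uniqueness: disjoint unions of a simplex on d vertices and one on i ≤ d vertices have h-polynomials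
spanning all polynomials of degree at most d. -/

/-! ### Descents and last letters: the recursion for A(n,i,j) -/

theorem card_descentSet {n : ℕ} (σ : Equiv.Perm (Fin (n + 1))) :
    (descentSet σ).card = ∑ k : Fin n, if σ k.succ < σ k.castSucc then 1 else 0 := by
  rw [← Finset.card_filter, ← Finset.card_map (s := Finset.filter _ _) Fin.castSuccEmb]
  refine congrArg Finset.card (Finset.ext fun k => ?_)
  simp only [descentSet, Finset.mem_filter, Finset.mem_univ, true_and, Finset.mem_map]
  constructor
  · rintro ⟨l, hl, h⟩
    have hk : (k : ℕ) < n := by have := l.2; omega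
    have hl' : l = (⟨k, hk⟩ : Fin n).succ := Fin.ext (by simpa using hl)
    exact ⟨⟨k, hk⟩, by simpa [← hl'] using h, rfl⟩
  · rintro ⟨a, ha, rfl⟩
    exact ⟨a.succ, by simp, ha⟩

theorem card_descentSet_le {n : ℕ} (σ : Equiv.Perm (Fin (n + 1))) :
    (descentSet σ).card ≤ n := by
  rw [card_descentSet, ← Finset.card_filter]
  exact (Finset.card_filter_le _ _).trans (by simp)

/-- The permutation with last letter `v` whose other letters are those of `τ`, standardized. -/
noncomputable def permSnoc {n : ℕ} (v : Fin (n + 1)) (τ : Equiv.Perm (Fin n)) :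
    Equiv.Perm (Fin (n + 1)) :=
  Equiv.ofBijective (Fin.snoc (α := fun _ => Fin (n + 1)) (fun k => v.succAbove (τ k)) v)
    (Finite.injective_iff_bijective.1 (Fin.snoc_injective_iff.2
      ⟨Fin.succAbove_right_injective.comp τ.injective, by
        rintro ⟨k, hk⟩
        exact Fin.succAbove_ne _ _ hk⟩))

@[simp] theorem permSnoc_last {n : ℕ} (v : Fin (n + 1)) (τ : Equiv.Perm (Fin n)) :
    permSnoc v τ (Fin.last n) = v := by
  simp [permSnoc]

@[simp] theorem permSnoc_castSucc {n : ℕ} (v : Fin (n + 1)) (τ : Equiv.Perm (Fin n))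
    (k : Fin n) : permSnoc v τ k.castSucc = v.succAbove (τ k) := by
  simp [permSnoc]

theorem permSnoc_injective {n : ℕ} (v : Fin (n + 1)) : Function.Injective (permSnoc v) := by
  intro τ τ' h
  ext k
  have := congrArg (fun f => f k.castSucc) h
  simp only [permSnoc_castSucc, Fin.succAbove_right_inj] at this
  rw [this]

theorem exists_permSnoc {n : ℕ} (σ : Equiv.Perm (Fin (n + 1))) :
    ∃ τ, permSnoc (σ (Fin.last n)) τ = σ := by
  have hbij : Function.Bijective
      (fun x : Fin (n + 1) × Equiv.Perm (Fin n) => permSnoc x.1 x.2) := by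
    rw [Fintype.bijective_iff_injective_and_card]
    constructor
    · rintro ⟨v, τ⟩ ⟨v', τ'⟩ h
      have hv : v = v' := by
        simpa using congrArg (fun f => f (Fin.last n)) h
      subst hv
      exact congrArg _ (permSnoc_injective v h)
    · simp [Fintype.card_perm, Nat.factorial_succ]
  obtain ⟨⟨v, τ⟩, rfl⟩ := hbij.2 σ
  exact ⟨τ, by simp⟩

/-- Standardization preserves the old descents. Old letters at least `v` move up by one, so the new
last step is a descent exactly when `v` is at most the old last letter. -/
theorem card_descentSet_permSnoc {n : ℕ} (v : Fin (n + 2)) (τ : Equiv.Perm (Fin (n + 1))) :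
    (descentSet (permSnoc v τ)).card =
      (descentSet τ).card + if v ≤ (τ (Fin.last n)).castSucc then 1 else 0 := by
  rw [card_descentSet, card_descentSet, Fin.sum_univ_castSucc]
  congr 1
  · refine Finset.sum_congr rfl fun k _ => ?_
    rw [Fin.succ_castSucc, permSnoc_castSucc, permSnoc_castSucc]
    simp
  · rw [Fin.succ_last, permSnoc_last, permSnoc_castSucc]
    simp [Fin.lt_succAbove_iff_le_castSucc]

/-- The number of permutations of `Fin (n + 1)` with `i` descents and last letter `v`. -/
def descentCount (n i : ℕ) (v : Fin (n + 1)) : ℕ :=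
  ({σ : Equiv.Perm (Fin (n + 1)) | (descentSet σ).card = i ∧ σ (Fin.last n) = v} :
    Finset _).card

theorem refinedEulerian_eq_descentCount {n i : ℕ} (j : Fin (n + 1)) :
    refinedEulerian (n + 1) i j = descentCount n i j.rev := by
  rw [refinedEulerian, descentCount, Fintype.card_subtype]
  congr 1
  ext σ
  simp only [Finset.mem_filter, Finset.mem_univ, true_and, and_congr_right_iff]
  intro _
  have hj := j.2
  constructor
  · rintro ⟨l, hl, h⟩
    have : l = Fin.last n := Fin.ext (by simpa using hl)
    subst this
    apply Fin.ext
    rw [Fin.val_rev]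
    omega
  · intro h
    refine ⟨Fin.last n, by simp, ?_⟩
    rw [h, Fin.val_rev]
    omega

theorem descentCount_succ (n i : ℕ) (v : Fin (n + 2)) :
    descentCount (n + 1) i v = ∑ w : Fin (n + 1), if v ≤ w.castSucc then
      (if i = 0 then 0 else descentCount n (i - 1) w) else descentCount n i w := by
  have h1 : descentCount (n + 1) i v = ({τ : Equiv.Perm (Fin (n + 1)) |
      (descentSet τ).card + (if v ≤ (τ (Fin.last n)).castSucc then 1 else 0) = i} :
        Finset _).card := by
    rw [descentCount, ← Finset.card_map ⟨permSnoc v, permSnoc_injective v⟩]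
    congr 1
    ext σ
    simp only [Finset.mem_filter, Finset.mem_univ, true_and, Finset.mem_map,
      Function.Embedding.coeFn_mk, ← card_descentSet_permSnoc]
    constructor
    · rintro ⟨h, rfl⟩
      obtain ⟨τ, hτ⟩ := exists_permSnoc σ
      exact ⟨τ, by rw [hτ, h], hτ⟩
    · rintro ⟨τ, h, rfl⟩
      exact ⟨h, by simp⟩
  rw [h1, Finset.card_eq_sum_card_fiberwise (f := fun τ => τ (Fin.last n)) (t := Finset.univ)
    (fun _ _ => by simp)]
  refine Finset.sum_congr rfl fun w _ => ?_
  rw [Finset.filter_filter]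
  split_ifs with hv hi
  · rw [Finset.card_eq_zero, Finset.filter_eq_empty_iff]
    rintro τ - ⟨h, rfl⟩
    rw [if_pos hv] at h
    omega
  · rw [descentCount]
    congr 1
    ext τ
    simp only [Finset.mem_filter, Finset.mem_univ, true_and, and_congr_left_iff]
    rintro rfl
    rw [if_pos hv]
    omega
  · rw [descentCount]
    congr 1
    ext τ
    simp only [Finset.mem_filter, Finset.mem_univ, true_and, and_congr_left_iff]
    rintro rfl
    rw [if_neg hv]
    omega

theorem refinedEulerian_succ (n i j : ℕ) (hj : j ≤ n + 1) :
    refinedEulerian (n + 2) i j = ∑ l ∈ Finset.range (n + 1), if l < j then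
      (if i = 0 then 0 else refinedEulerian (n + 1) (i - 1) l)
        else refinedEulerian (n + 1) i l := by
  have h := refinedEulerian_eq_descentCount (i := i) (⟨j, by omega⟩ : Fin (n + 2))
  simp only at h
  rw [h, descentCount_succ, ← Equiv.sum_comp Fin.revPerm, ← Fin.sum_univ_eq_sum_range
    (fun l => if l < j then (if i = 0 then 0 else refinedEulerian (n + 1) (i - 1) l)
        else refinedEulerian (n + 1) i l)]
  refine Finset.sum_congr rfl fun l _ => ?_
  rw [refinedEulerian_eq_descentCount, refinedEulerian_eq_descentCount]
  have hl := l.2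
  -- Column indices count letters from the top, so `v ≤ w` turns into `l < j`.
  refine if_congr ?_ rfl rfl
  rw [Fin.le_def]
  simp only [Fin.val_rev, Fin.revPerm_apply, Fin.val_castSucc]
  omega

theorem refinedEulerian_one (i : ℕ) : refinedEulerian 1 i 0 = if i = 0 then 1 else 0 := by
  have h := refinedEulerian_eq_descentCount (i := i) (0 : Fin 1)
  simp only [Fin.val_zero, zero_add] at h
  rw [h, descentCount]
  split_ifs with hi
  · subst hi
    rw [Finset.filter_true_of_mem, Finset.card_univ, Fintype.card_perm]
    · simp
    · intro σ _
      exact ⟨by simp [card_descentSet], Subsingleton.elim (α := Fin 1) _ _⟩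
  · rw [Finset.card_eq_zero, Finset.filter_eq_empty_iff]
    rintro σ - ⟨hσ, -⟩
    simp [card_descentSet] at hσ
    omega

theorem refinedEulerian_eq_zero {n i : ℕ} (j : ℕ) (hi : n < i) :
    refinedEulerian (n + 1) i j = 0 := by
  rw [refinedEulerian, Fintype.card_eq_zero_iff]
  exact ⟨fun σ => by have := card_descentSet_le σ.1; have := σ.2.1; omega⟩

/-! ### Periodic continuation and total positivity of order 2 -/

/-- The matrix `A(d + 1, i, j)` with its columns continued to all `q : ℕ`: a shift by `d + 1`
columns amounts to a shift by one row. -/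
def periodicEulerian (d i q : ℕ) : ℕ :=
  if q / (d + 1) ≤ i then refinedEulerian (d + 1) (i - q / (d + 1)) (q % (d + 1)) else 0

theorem sum_range_add_eq_sum_ite {N j : ℕ} (hj : j ≤ N) (g : ℕ → ℕ) :
    ∑ l ∈ Finset.range N, g (j + l) =
      ∑ l ∈ Finset.range N, if l < j then g (l + N) else g l := by
  obtain ⟨k, rfl⟩ := Nat.exists_eq_add_of_le hj
  conv_lhs => rw [add_comm j k, Finset.sum_range_add, add_comm]
  rw [Finset.sum_range_add]
  congr 1
  · refine Finset.sum_congr rfl fun l hl => ?_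
    rw [if_pos (Finset.mem_range.1 hl)]
    congr 1
    ring
  · exact Finset.sum_congr rfl fun l _ => by rw [if_neg (by omega)]

theorem periodicEulerian_mul_add (d i s : ℕ) {l : ℕ} (hl : l < d + 1) :
    periodicEulerian d i ((d + 1) * s + l) =
      if s ≤ i then refinedEulerian (d + 1) (i - s) l else 0 := by
  rw [periodicEulerian, Nat.mul_add_div (by omega), Nat.div_eq_of_lt hl, Nat.mul_add_mod,
    Nat.mod_eq_of_lt hl, add_zero]

/-- For q = (d+2)s + j the window starts at (d+1)s + j = q - s. Its entries beyond the current
period wrap around to the columns l < j with the row lowered by one, which is the first case of the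
recursion. -/
theorem periodicEulerian_succ (d i q : ℕ) :
    periodicEulerian (d + 1) i q =
      ∑ l ∈ Finset.range (d + 1), periodicEulerian d i (q - q / (d + 2) + l) := by
  obtain ⟨s, j, hj, rfl⟩ : ∃ s j, j < d + 2 ∧ q = (d + 2) * s + j :=
    ⟨q / (d + 2), q % (d + 2), Nat.mod_lt _ (by omega), (Nat.div_add_mod _ _).symm⟩
  have h1 : (d + 2) * s + j - ((d + 2) * s + j) / (d + 2) = (d + 1) * s + j := by
    rw [Nat.mul_add_div (by omega), Nat.div_eq_of_lt hj, add_zero]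
    have : (d + 2) * s = (d + 1) * s + s := by ring
    omega
  rw [h1, periodicEulerian_mul_add (d + 1) i s hj]
  simp only [add_assoc ((d + 1) * s)]
  have h2 : ∀ l ∈ Finset.range (d + 1), (if l < j then
      periodicEulerian d i ((d + 1) * s + (l + (d + 1))) else
        periodicEulerian d i ((d + 1) * s + l)) = if s ≤ i then (if l < j then
      (if i - s = 0 then 0 else refinedEulerian (d + 1) (i - s - 1) l)
        else refinedEulerian (d + 1) (i - s) l) else 0 := fun l hl => by
    rw [show (d + 1) * s + (l + (d + 1)) = (d + 1) * (s + 1) + l by ring,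
      periodicEulerian_mul_add d i _ (Finset.mem_range.1 hl),
      periodicEulerian_mul_add d i _ (Finset.mem_range.1 hl), Nat.sub_sub]
    split_ifs <;> first | rfl | omega
  rw [sum_range_add_eq_sum_ite (N := d + 1) (by omega)
    (fun p => periodicEulerian d i ((d + 1) * s + p)), refinedEulerian_succ _ _ _ (by omega),
    Finset.sum_congr rfl h2]
  split_ifs <;> simp

theorem sum_mul_sum_le_of_forall_le {f g : ℕ → ℕ} (h : ∀ p q, p ≤ q → f q * g p ≤ f p * g q)
    {S T : Finset ℕ} (hST : ∀ x ∈ S, ∀ y ∈ T, x ≤ y) :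
    (∑ y ∈ T, f y) * ∑ x ∈ S, g x ≤ (∑ x ∈ S, f x) * ∑ y ∈ T, g y := by
  rw [Finset.sum_mul_sum, Finset.sum_mul_sum, Finset.sum_comm]
  exact Finset.sum_le_sum fun x hx => Finset.sum_le_sum fun y hy => h _ _ (hST x hx y hy)

/-- The product of the two sums over the common part of the windows occurs on both sides and
cancels. In the three remaining comparisons one index set lies to the left of the other. -/
theorem sum_window_mul_sum_window_le {f g : ℕ → ℕ}
    (h : ∀ p q, p ≤ q → f q * g p ≤ f p * g q) (N : ℕ) {p q : ℕ} (hpq : p ≤ q) :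
    (∑ l ∈ Finset.range N, f (q + l)) * ∑ l ∈ Finset.range N, g (p + l) ≤
      (∑ l ∈ Finset.range N, f (p + l)) * ∑ l ∈ Finset.range N, g (q + l) := by
  have hw : ∀ (u : ℕ → ℕ) (r : ℕ),
      ∑ l ∈ Finset.range N, u (r + l) = ∑ x ∈ Finset.Ico r (r + N), u x := fun u r => by
    rw [Finset.sum_Ico_eq_sum_range, Nat.add_sub_cancel_left]
  simp only [hw]
  set S := Finset.Ico p (p + N)
  set T := Finset.Ico q (q + N)
  have hS : ∀ u : ℕ → ℕ, ∑ x ∈ S, u x = ∑ x ∈ S ∩ T, u x + ∑ x ∈ S \ T, u x :=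
    fun u => (Finset.sum_inter_add_sum_sdiff S T u).symm
  have hT : ∀ u : ℕ → ℕ, ∑ x ∈ T, u x = ∑ x ∈ S ∩ T, u x + ∑ x ∈ T \ S, u x :=
    fun u => by rw [Finset.inter_comm]; exact (Finset.sum_inter_add_sum_sdiff T S u).symm
  have h1 := sum_mul_sum_le_of_forall_le h (S := S \ T) (T := S ∩ T) (by
    simp only [Finset.mem_sdiff, Finset.mem_inter, S, T, Finset.mem_Ico]
    intros; omega)
  have h2 := sum_mul_sum_le_of_forall_le h (S := S ∩ T) (T := T \ S) (by
    simp only [Finset.mem_sdiff, Finset.mem_inter, S, T, Finset.mem_Ico]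
    intros; omega)
  have h3 := sum_mul_sum_le_of_forall_le h (S := S \ T) (T := T \ S) (by
    simp only [Finset.mem_sdiff, S, T, Finset.mem_Ico]
    intros; omega)
  rw [hS g, hS f, hT f, hT g]
  linarith

theorem periodicEulerian_mul_le (d : ℕ) {i i' p q : ℕ} (hi : i ≤ i') (hpq : p ≤ q) :
    periodicEulerian d i q * periodicEulerian d i' p ≤
      periodicEulerian d i p * periodicEulerian d i' q := by
  induction d generalizing p q with
  | zero =>
    have h0 : ∀ i p, periodicEulerian 0 i p = if p = i then 1 else 0 := by
      intro i p
      simp only [periodicEulerian, zero_add, Nat.div_one, Nat.mod_one, refinedEulerian_one]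
      split_ifs <;> omega
    simp only [h0]
    split_ifs <;> omega
  | succ d ih =>
    simp only [periodicEulerian_succ]
    refine sum_window_mul_sum_window_le (fun p q h => ih h) _ ?_
    -- The window start q - ⌊q/(d+2)⌋ is monotone, since the floor grows by at most k when q grows
    -- by k.
    obtain ⟨k, rfl⟩ := Nat.exists_eq_add_of_le hpq
    have h1 : (p + k) / (d + 2) ≤ p / (d + 2) + k := by
      rw [← Nat.add_mul_div_right p k (by omega : 0 < d + 2)]
      exact Nat.div_le_div_right (by nlinarith)
    have h2 := Nat.div_le_self p (d + 2)
    omega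

theorem refinedEulerian_mul_le {d i i' j j' : ℕ} (hi : i ≤ i') (hj : j ≤ j') (hj' : j' ≤ d) :
    refinedEulerian (d + 1) i j' * refinedEulerian (d + 1) i' j ≤
      refinedEulerian (d + 1) i j * refinedEulerian (d + 1) i' j' := by
  have h0 : ∀ i j, j ≤ d → periodicEulerian d i j = refinedEulerian (d + 1) i j := by
    intro i j hj
    simpa using periodicEulerian_mul_add d i 0 (l := j) (by omega)
  have := periodicEulerian_mul_le d hi hj
  rwa [h0 _ _ hj', h0 _ _ (hj.trans hj'), h0 _ _ hj', h0 _ _ (hj.trans hj')] at this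

theorem isTP_two_refinedEulerian (d : ℕ) :
    Matrix.IsTP 2 (Matrix.of fun i j : Fin (d + 1) => (refinedEulerian (d + 1) i j : ℝ)) := by
  intro k hk1 hk2 rows cols
  obtain rfl | rfl : k = 1 ∨ k = 2 := by omega
  · simp
  · have hr : rows 0 ≤ rows 1 := rows.monotone (by decide)
    have hc : cols 0 ≤ cols 1 := cols.monotone (by decide)
    have := refinedEulerian_mul_le (d := d) (Fin.le_def.1 hr) (Fin.le_def.1 hc)
      (Nat.lt_succ_iff.1 (cols 1).2)
    rw [Matrix.det_fin_two]
    simp only [Matrix.submatrix_apply, Matrix.of_apply, sub_nonneg]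
    exact_mod_cast this

/-! ### Counting chains: face numbers of the subdivision -/

/-- The number of chains of `k` nonempty subsets whose largest member is a given set with `j`
elements. -/
def chainCount : ℕ → ℕ → ℕ
  | 0, j => if j = 0 then 1 else 0
  | k + 1, j => ∑ i ∈ Finset.range j, j.choose i * chainCount k i

theorem chainCount_eq_zero {k j : ℕ} (h : j < k) : chainCount k j = 0 := by
  induction k generalizing j with
  | zero => omega
  | succ k ih =>
    rw [chainCount]
    refine Finset.sum_eq_zero fun i hi => ?_
    rw [ih (by have := Finset.mem_range.1 hi; omega), mul_zero]

theorem IsChain.finset_sup_mem {V : Type*} [DecidableEq V] {c : Finset (Finset V)}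
    (hc : IsChain (· ⊆ ·) (c : Set (Finset V))) (hne : c.Nonempty) : c.sup id ∈ c := by
  obtain ⟨m, hm⟩ := c.exists_maximal hne
  have : c.sup id = m := by
    refine le_antisymm (Finset.sup_le fun x hx => ?_) (Finset.le_sup (f := id) hm.1)
    rcases hc.total hx hm.1 with h | h
    · exact h
    · exact hm.2 hx h
  rw [this]
  exact hm.1

open Classical in
/-- The chains of `k` nonempty finite sets with union `F`. -/
noncomputable def chainsWithSup {V : Type*} (k : ℕ) (F : Finset V) :
    Finset (Finset (Finset V)) :=
  {c ∈ F.powerset.powerset | ∅ ∉ c ∧ IsChain (· ⊆ ·) (c : Set (Finset V)) ∧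
    c.sup id = F ∧ c.card = k}

open Classical in
theorem mem_chainsWithSup {V : Type*} {k : ℕ} {F : Finset V} {c : Finset (Finset V)} :
    c ∈ chainsWithSup k F ↔ ∅ ∉ c ∧ IsChain (· ⊆ ·) (c : Set (Finset V)) ∧
      c.sup id = F ∧ c.card = k := by
  rw [chainsWithSup, Finset.mem_filter, and_iff_right_iff_imp]
  rintro ⟨-, -, h, -⟩
  rw [Finset.mem_powerset]
  intro G hG
  rw [Finset.mem_powerset, ← h]
  exact Finset.le_sup (f := id) hG

open Classical in
-- Removing the largest member `F` leaves a chain whose union `G` is a proper subset of `F`;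
-- conversely `F` can be added to any such chain.
theorem card_chainsWithSup_succ {V : Type*} (k : ℕ) (F : Finset V) :
    (chainsWithSup (k + 1) F).card = ∑ G ∈ F.ssubsets, (chainsWithSup k G).card := by
  have hmem : ∀ c ∈ chainsWithSup (k + 1) F, F ∈ c := fun c hc => by
    obtain ⟨-, h2, h3, h4⟩ := mem_chainsWithSup.1 hc
    rw [← h3]
    exact h2.finset_sup_mem (Finset.card_pos.1 (by omega))
  rw [Finset.card_eq_sum_card_fiberwise (f := fun c => (c.erase F).sup id) (t := F.ssubsets)]
  · refine Finset.sum_congr rfl fun G hG => ?_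
    rw [Finset.mem_ssubsets] at hG
    refine Finset.card_nbij' (fun c => c.erase F) (fun c => insert F c) ?_ ?_ ?_ ?_
    · intro c hc
      rw [Finset.mem_coe, Finset.mem_filter] at hc
      have hF := hmem c hc.1
      obtain ⟨h1, h2, h3, h4⟩ := mem_chainsWithSup.1 hc.1
      rw [Finset.mem_coe, mem_chainsWithSup]
      refine ⟨fun h => h1 (Finset.mem_of_mem_erase h), h2.mono (by simp), hc.2, ?_⟩
      rw [Finset.card_erase_of_mem hF, h4, Nat.add_sub_cancel]
    · intro c hc
      obtain ⟨h1, h2, h3, h4⟩ := mem_chainsWithSup.1 hc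
      have hlt : ∀ x ∈ c, x ⊂ F := fun x hx =>
        lt_of_le_of_lt (h3 ▸ Finset.le_sup (f := id) hx) hG
      have hF : F ∉ c := fun h => (hlt F h).ne rfl
      rw [Finset.mem_coe, Finset.mem_filter, mem_chainsWithSup, Finset.erase_insert hF]
      refine ⟨⟨?_, ?_, ?_, by rw [Finset.card_insert_of_notMem hF, h4]⟩, h3⟩
      · rw [Finset.mem_insert, not_or]
        refine ⟨?_, h1⟩
        rintro rfl
        exact Finset.not_ssubset_empty _ hG
      · rw [Finset.coe_insert]
        exact h2.insert fun b hb _ => Or.inr (hlt b hb).subset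
      · rw [Finset.sup_insert, h3]
        exact sup_eq_left.2 hG.subset
    · intro c hc
      exact Finset.insert_erase (hmem c (Finset.mem_filter.1 hc).1)
    · intro c hc
      obtain ⟨h1, h2, h3, h4⟩ := mem_chainsWithSup.1 hc
      refine Finset.erase_insert fun h => ?_
      have : F ⊆ G := h3 ▸ Finset.le_sup (f := id) h
      exact hG.not_subset this
  · intro c hc
    have hF := hmem c hc
    obtain ⟨h1, h2, h3, h4⟩ := mem_chainsWithSup.1 hc
    rw [Finset.mem_coe, Finset.mem_ssubsets, Finset.ssubset_iff_subset_ne]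
    constructor
    · conv_rhs => rw [← h3]
      exact Finset.sup_mono (Finset.erase_subset _ _)
    · intro h
      simp only at h
      -- If nothing remains, the union is ∅, which differs from `F` because ∅ is not in `c`.
      -- Otherwise the union belongs to the remaining chain, from which `F` was removed.
      rcases (c.erase F).eq_empty_or_nonempty with he | he
      · rw [he, Finset.sup_empty, Finset.bot_eq_empty] at h
        exact h1 (h ▸ hF)
      · have h2' : IsChain (· ⊆ ·) ((c.erase F : Finset (Finset V)) : Set (Finset V)) :=
          h2.mono (by simp)
        have := h2'.finset_sup_mem he
        rw [h] at this
        simp at this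

theorem card_chainsWithSup {V : Type*} (k : ℕ) (F : Finset V) :
    (chainsWithSup k F).card = chainCount k F.card := by
  classical
  induction k generalizing F with
  | zero =>
    rw [chainCount]
    split_ifs with h
    · rw [Finset.card_eq_one]
      refine ⟨∅, Finset.ext fun c => ?_⟩
      rw [mem_chainsWithSup, Finset.mem_singleton, Finset.card_eq_zero]
      constructor
      · exact fun h => h.2.2.2
      · rintro rfl
        simpa using (Finset.card_eq_zero.1 h).symm
    · rw [Finset.card_eq_zero, Finset.eq_empty_iff_forall_notMem]
      intro c hc
      obtain ⟨-, -, h3, h4⟩ := mem_chainsWithSup.1 hc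
      rw [Finset.card_eq_zero] at h4
      subst h4
      exact h (by rw [← h3]; simp)
  | succ k ih =>
    rw [card_chainsWithSup_succ, chainCount]
    simp only [ih]
    have h := Finset.sum_powerset_apply_card (fun j => chainCount k j) (x := F)
    rw [Finset.sum_range_succ, Nat.choose_self, one_smul,
      ← Finset.sum_erase_add _ _ (Finset.mem_powerset_self F)] at h
    simpa [Finset.ssubsets] using add_right_cancel h

namespace PreAbstractSimplicialComplex

theorem faceNumber_barycentricSubdivision {V : Type*} [Finite V] {d : ℕ}
    {Δ : PreAbstractSimplicialComplex V} (hΔ : Δ.HasDimPred d) (k : ℕ) :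
    Δ.barycentricSubdivision.faceNumber k =
      ∑ j ∈ Finset.range (d + 1), Δ.faceNumber j * chainCount k j := by
  classical
  have hfin : Δ.allFaces.Finite := Set.toFinite _
  have h1 : {s ∈ Δ.barycentricSubdivision.allFaces | s.card = k} =
      ((hfin.toFinset.biUnion (chainsWithSup k) : Finset _) : Set (Finset (Finset V))) := by
    ext c
    simp only [Set.mem_ofPred_eq, Finset.coe_biUnion, Set.mem_iUnion, Finset.mem_coe,
      Set.Finite.mem_toFinset, mem_chainsWithSup, exists_prop]
    constructor
    · rintro ⟨rfl | ⟨hne, hsub, hc⟩, rfl⟩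
      · exact ⟨∅, Or.inl rfl, by simp⟩
      · refine ⟨c.sup id, Or.inr (hsub (hc.finset_sup_mem hne)), fun h => ?_, hc, rfl, rfl⟩
        exact Finset.not_nonempty_empty (Δ.isRelLowerSet_faces (hsub h)).1
    · rintro ⟨F, hF, h1, h2, h3, h4⟩
      refine ⟨?_, h4⟩
      rcases c.eq_empty_or_nonempty with rfl | hne
      · exact Or.inl rfl
      · refine Or.inr ⟨hne, fun G hG => ?_, h2⟩
        have hGF : G ⊆ F := h3 ▸ Finset.le_sup (f := id) hG
        have hG' : G.Nonempty := Finset.nonempty_iff_ne_empty.2 fun h => h1 (h ▸ hG)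
        rcases hF with rfl | hF
        · exact absurd (Finset.subset_empty.1 hGF) hG'.ne_empty
        · exact (Δ.isRelLowerSet_faces hF).2 hGF hG'
  have h2 : ∀ j, Δ.faceNumber j = ({s ∈ hfin.toFinset | s.card = j} : Finset _).card := by
    intro j
    rw [faceNumber, ← Set.ncard_coe_finset]
    simp
  rw [faceNumber, h1, Set.ncard_coe_finset, Finset.card_biUnion]
  · simp only [card_chainsWithSup, h2]
    rw [← Finset.sum_fiberwise_of_maps_to (g := Finset.card) (t := Finset.range (d + 1))]
    · refine Finset.sum_congr rfl fun j _ => ?_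
      rw [← smul_eq_mul, ← Finset.sum_const]
      refine Finset.sum_congr rfl fun s hs => ?_
      rw [(Finset.mem_filter.1 hs).2]
    · intro s hs
      have := hΔ.2 ⟨s, by simpa using hs, rfl⟩
      simp only [Finset.mem_range]
      omega
  · intro F _ G _ hFG
    rw [Function.onFun, Finset.disjoint_left]
    intro c hc hc'
    exact hFG ((mem_chainsWithSup.1 hc).2.2.1.symm.trans (mem_chainsWithSup.1 hc').2.2.1)

end PreAbstractSimplicialComplex

/-! ### Common recursions of the two families of polynomials -/

/-- The contribution `∑ k, c(k, j) (X - 1) ^ (d - k)` of a face with `j` elements to the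
`h`-polynomial of a barycentric subdivision. -/
noncomputable def chainPoly (d j : ℕ) : ℝ[X] :=
  ∑ k ∈ Finset.range (d + 1), (chainCount k j : ℝ[X]) * (X - 1) ^ (d - k)

theorem chainPoly_succ {d j : ℕ} (hj : j ≤ d) : chainPoly (d + 1) j = (X - 1) * chainPoly d j := by
  rw [chainPoly, Finset.sum_range_succ, chainCount_eq_zero (by omega), Nat.cast_zero, zero_mul,
    add_zero, chainPoly, Finset.mul_sum]
  refine Finset.sum_congr rfl fun k hk => ?_
  rw [Nat.succ_sub (by have := Finset.mem_range.1 hk; omega), pow_succ]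
  ring

theorem chainPoly_succ_self (d : ℕ) : chainPoly (d + 1) (d + 1) =
    ∑ j ∈ Finset.range (d + 1), ((d + 1).choose j : ℝ[X]) * chainPoly d j := by
  rw [chainPoly, Finset.sum_range_succ']
  simp only [chainCount, chainPoly, Finset.mul_sum]
  rw [Finset.sum_comm, if_neg (by omega), Nat.cast_zero, zero_mul, add_zero]
  refine Finset.sum_congr rfl fun k _ => ?_
  rw [Nat.cast_sum, Finset.sum_mul, Nat.add_sub_add_right]
  refine Finset.sum_congr rfl fun j _ => ?_
  push_cast
  ring

/-- The image of the `m`-th unit `h`-vector under the change of `h`-polynomial caused by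
barycentric subdivision. -/
noncomputable def subdivisionPoly (d m : ℕ) : ℝ[X] :=
  ∑ j ∈ Finset.range (d + 1), ((d - m).choose (d - j) : ℝ[X]) * chainPoly d j

/-- Pascal's rule, with the factor X - 1 supplied by `chainPoly_succ`. -/
theorem subdivisionPoly_succ {d m : ℕ} (hm : m ≤ d) :
    subdivisionPoly (d + 1) m =
      subdivisionPoly (d + 1) (m + 1) + (X - 1) * subdivisionPoly d m := by
  simp only [subdivisionPoly]
  rw [Finset.sum_range_succ, Finset.sum_range_succ _ (d + 1), Finset.mul_sum,
    add_right_comm, ← Finset.sum_add_distrib]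
  simp only [Nat.sub_self, Nat.choose_zero_right]
  congr 1
  refine Finset.sum_congr rfl fun j hj => ?_
  have hj := Nat.lt_succ_iff.1 (Finset.mem_range.1 hj)
  rw [chainPoly_succ hj, Nat.succ_sub hm, Nat.succ_sub hj, Nat.choose_succ_succ,
    Nat.add_sub_add_right]
  push_cast
  ring

theorem sum_range_choose_right (n k : ℕ) :
    ∑ m ∈ Finset.range n, m.choose k = n.choose (k + 1) := by
  induction n with
  | zero => simp
  | succ n ih => rw [Finset.sum_range_succ, ih, Nat.choose_succ_succ, add_comm]

/-- Only j = d+1 survives on the left; splitting off the largest chain member gives binomials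
C(d+1,j), which the hockey-stick identity recovers on the right. -/
theorem subdivisionPoly_succ_self (d : ℕ) : subdivisionPoly (d + 1) (d + 1) =
    ∑ m ∈ Finset.range (d + 1), subdivisionPoly d m := by
  have h1 : subdivisionPoly (d + 1) (d + 1) = chainPoly (d + 1) (d + 1) := by
    rw [subdivisionPoly, Finset.sum_range_succ, Finset.sum_eq_zero]
    · simp
    · intro j hj
      rw [Nat.sub_self, Nat.choose_eq_zero_of_lt (by have := Finset.mem_range.1 hj; omega)]
      simp
  rw [h1, chainPoly_succ_self]
  simp only [subdivisionPoly]
  rw [Finset.sum_comm]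
  refine Finset.sum_congr rfl fun j hj => ?_
  have hj := Nat.lt_succ_iff.1 (Finset.mem_range.1 hj)
  rw [← Finset.sum_mul, ← Nat.cast_sum]
  have h2 := Finset.sum_range_reflect (fun m => m.choose (d - j)) (d + 1)
  simp only [Nat.add_sub_cancel] at h2
  rw [h2, sum_range_choose_right,
    ← Nat.choose_symm (show j ≤ d + 1 by omega), Nat.succ_sub hj]

/-- The polynomial `∑ i, A(d + 1, i, m) X ^ (d - i)` of the `m`-th column of the matrix
`A(d + 1, i, j)`. -/
noncomputable def eulerianPoly (d m : ℕ) : ℝ[X] :=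
  ∑ i ∈ Finset.range (d + 1), (refinedEulerian (d + 1) i m : ℝ[X]) * X ^ (d - i)

theorem eulerianPoly_succ {d j : ℕ} (hj : j ≤ d + 1) : eulerianPoly (d + 1) j =
    ∑ l ∈ Finset.range (d + 1), if l < j then eulerianPoly d l else X * eulerianPoly d l := by
  rw [eulerianPoly]
  simp only [refinedEulerian_succ d _ j hj, Nat.cast_sum, Finset.sum_mul]
  rw [Finset.sum_comm]
  refine Finset.sum_congr rfl fun l _ => ?_
  split_ifs with hl
  · rw [Finset.sum_range_succ', eulerianPoly]
    simp
  · rw [Finset.sum_range_succ, refinedEulerian_eq_zero l (Nat.lt_succ_self d), eulerianPoly,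
      Finset.mul_sum, Nat.cast_zero, zero_mul, add_zero]
    refine Finset.sum_congr rfl fun i hi => ?_
    rw [Nat.succ_sub (Nat.lt_succ_iff.1 (Finset.mem_range.1 hi)), pow_succ]
    ring

/-- Passing from column m to m+1 changes only the summand l = m, from X times `eulerianPoly d m` to
`eulerianPoly d m`. -/
theorem eulerianPoly_succ_eq_add {d m : ℕ} (hm : m ≤ d) : eulerianPoly (d + 1) m =
    eulerianPoly (d + 1) (m + 1) + (X - 1) * eulerianPoly d m := by
  rw [eulerianPoly_succ (by omega), eulerianPoly_succ (by omega), ← sub_eq_iff_eq_add',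
    ← Finset.sum_sub_distrib, Finset.sum_eq_single m]
  · rw [if_neg (lt_irrefl m), if_pos (Nat.lt_succ_self m)]
    ring
  · intro l _ hl
    have : l < m ↔ l < m + 1 := by omega
    simp only [this, sub_self]
  · intro h
    exact absurd (Finset.mem_range.2 (Nat.lt_succ_iff.2 hm)) h

theorem eulerianPoly_eq_subdivisionPoly {d m : ℕ} (hm : m ≤ d) :
    eulerianPoly d m = subdivisionPoly d m := by
  induction d generalizing m with
  | zero =>
    obtain rfl : m = 0 := by omega
    simp [eulerianPoly, subdivisionPoly, chainPoly, chainCount, refinedEulerian_one]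
  | succ d ih =>
    -- In each dimension the last column is a sum over the previous dimension; the others follow
    -- from right to left.
    induction hm using Nat.decreasingInduction with
    | self =>
      rw [eulerianPoly_succ le_rfl, subdivisionPoly_succ_self]
      refine Finset.sum_congr rfl fun l hl => ?_
      have hl := Finset.mem_range.1 hl
      rw [if_pos hl, ih (by omega)]
    | of_succ m hm h =>
      have hm := Nat.lt_succ_iff.1 hm
      rw [eulerianPoly_succ_eq_add hm, h, ih hm, ← subdivisionPoly_succ hm]

theorem coeff_eulerianPoly {d i : ℕ} (m : ℕ) (hi : i ≤ d) :
    (eulerianPoly d m).coeff (d - i) = refinedEulerian (d + 1) i m := by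
  rw [eulerianPoly, finsetSum_coeff, Finset.sum_eq_single i]
  · rw [← C_eq_natCast, coeff_C_mul, coeff_X_pow, if_pos rfl, mul_one]
  · intro k hk hki
    have hk := Finset.mem_range.1 hk
    rw [← C_eq_natCast, coeff_C_mul, coeff_X_pow, if_neg (by omega), mul_zero]
  · intro h
    exact absurd (Finset.mem_range.2 (Nat.lt_succ_iff.2 hi)) h

/-! ### The h-polynomial of the subdivision -/

namespace PreAbstractSimplicialComplex

variable {V : Type*}

theorem hPoly_eq_sum (d : ℕ) (Δ : PreAbstractSimplicialComplex V) : Δ.hPoly d =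
    ∑ j ∈ Finset.range (d + 1), (Δ.faceNumber j : ℝ[X]) * (X - 1) ^ (d - j) := by
  rw [hPoly, fPoly, Polynomial.sum_comp]
  simp

theorem natDegree_hPoly_le (d : ℕ) (Δ : PreAbstractSimplicialComplex V) :
    (Δ.hPoly d).natDegree ≤ d := by
  rw [hPoly_eq_sum]
  refine natDegree_sum_le_of_forall_le _ _ fun j _ => ?_
  rw [← C_eq_natCast]
  refine (natDegree_C_mul_le _ _).trans ?_
  rw [← C_1]
  refine (natDegree_pow_le_of_le (d - j) (natDegree_X_sub_C_le (1 : ℝ))).trans ?_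
  omega

theorem hPoly_eq_sum_coeff (d : ℕ) (Δ : PreAbstractSimplicialComplex V) : Δ.hPoly d =
    ∑ m ∈ Finset.range (d + 1), C ((Δ.hPoly d).coeff (d - m)) * X ^ (d - m) := by
  conv_lhs => rw [(Δ.hPoly d).as_sum_range_C_mul_X_pow' (Nat.lt_succ_iff.2
    (natDegree_hPoly_le d Δ)), ← Finset.sum_range_reflect]
  rfl

/-- Compare coefficients in f(x) = h(x+1). -/
theorem faceNumber_eq_sum {d j : ℕ} (hj : j ≤ d) (Δ : PreAbstractSimplicialComplex V) :
    (Δ.faceNumber j : ℝ) = ∑ m ∈ Finset.range (d + 1),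
      (Δ.hPoly d).coeff (d - m) * ((d - m).choose (d - j) : ℝ) := by
  have h1 : Δ.fPoly d = (Δ.hPoly d).comp (X + 1) := by
    rw [hPoly, comp_assoc]
    simp
  have h2 : (Δ.fPoly d).coeff (d - j) = Δ.faceNumber j := by
    rw [fPoly, finsetSum_coeff, Finset.sum_eq_single j]
    · rw [coeff_C_mul, coeff_X_pow, if_pos rfl, mul_one]
    · intro k hk hkj
      have hk := Finset.mem_range.1 hk
      rw [coeff_C_mul, coeff_X_pow, if_neg (by omega), mul_zero]
    · intro h
      exact absurd (Finset.mem_range.2 (Nat.lt_succ_iff.2 hj)) h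
  rw [← h2, h1]
  conv_lhs => rw [hPoly_eq_sum_coeff, Polynomial.sum_comp, finsetSum_coeff]
  refine Finset.sum_congr rfl fun m _ => ?_
  rw [mul_comp, C_comp, pow_comp, X_comp, coeff_C_mul, coeff_X_add_one_pow]

theorem hPoly_barycentricSubdivision [Finite V] {d : ℕ} {Δ : PreAbstractSimplicialComplex V}
    (hΔ : Δ.HasDimPred d) : Δ.barycentricSubdivision.hPoly d =
      ∑ m ∈ Finset.range (d + 1), C ((Δ.hPoly d).coeff (d - m)) * eulerianPoly d m := by
  have h1 : Δ.barycentricSubdivision.hPoly d =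
      ∑ j ∈ Finset.range (d + 1), (Δ.faceNumber j : ℝ[X]) * chainPoly d j := by
    rw [hPoly_eq_sum]
    simp only [faceNumber_barycentricSubdivision hΔ, chainPoly, Finset.mul_sum, Nat.cast_sum,
      Finset.sum_mul]
    rw [Finset.sum_comm]
    refine Finset.sum_congr rfl fun j _ => Finset.sum_congr rfl fun k _ => ?_
    push_cast
    ring
  have h2 : ∀ m ∈ Finset.range (d + 1), C ((Δ.hPoly d).coeff (d - m)) * eulerianPoly d m =
      ∑ j ∈ Finset.range (d + 1), C ((Δ.hPoly d).coeff (d - m) * ((d - m).choose (d - j) : ℝ)) *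
        chainPoly d j := fun m hm => by
    rw [eulerianPoly_eq_subdivisionPoly (Nat.lt_succ_iff.1 (Finset.mem_range.1 hm)),
      subdivisionPoly, Finset.mul_sum]
    refine Finset.sum_congr rfl fun j _ => ?_
    rw [C_mul, C_eq_natCast, mul_assoc]
  rw [h1, Finset.sum_congr rfl h2, Finset.sum_comm]
  refine Finset.sum_congr rfl fun j hj => ?_
  rw [← Finset.sum_mul, ← map_sum, ← faceNumber_eq_sum (Nat.lt_succ_iff.1 (Finset.mem_range.1 hj)),
    C_eq_natCast]

end PreAbstractSimplicialComplex

theorem isBarycentricHMatrix_refinedEulerian (d : ℕ) : IsBarycentricHMatrix d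
    (Matrix.of fun i j : Fin (d + 1) => (refinedEulerian (d + 1) i j : ℝ)) := by
  intro V _ Δ hΔ
  ext i
  rw [PreAbstractSimplicialComplex.hVector,
    PreAbstractSimplicialComplex.hPoly_barycentricSubdivision hΔ, finsetSum_coeff,
    Matrix.mulVec, dotProduct, ← Fin.sum_univ_eq_sum_range
      (fun m => (C ((Δ.hPoly d).coeff (d - m)) * eulerianPoly d m).coeff (d - i))]
  refine Finset.sum_congr rfl fun m _ => ?_
  rw [coeff_C_mul, coeff_eulerianPoly _ (Nat.lt_succ_iff.1 i.2), mul_comm]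
  rfl

/-! ### Uniqueness: enough test complexes -/

namespace PreAbstractSimplicialComplex

/-- The union of the simplices on the vertex sets `A` and `B`. -/
def twoSimplices {V : Type*} (A B : Finset V) : PreAbstractSimplicialComplex V where
  faces := {s | s.Nonempty ∧ (s ⊆ A ∨ s ⊆ B)}
  isRelLowerSet_faces := by
    rintro s ⟨hs, h⟩
    exact ⟨hs, fun t ht hne => ⟨hne, h.imp (ht.trans ·) (ht.trans ·)⟩⟩

theorem hasDimPred_twoSimplices {V : Type*} {A B : Finset V} (h : B.card ≤ A.card) :
    (twoSimplices A B).HasDimPred A.card := by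
  constructor
  · refine ⟨A, ?_, rfl⟩
    rcases A.eq_empty_or_nonempty with hA | hA
    · exact Or.inl hA
    · exact Or.inr ⟨hA, Or.inl subset_rfl⟩
  · rintro _ ⟨s, rfl | ⟨-, hs | hs⟩, rfl⟩
    · simp
    · exact Finset.card_le_card hs
    · exact (Finset.card_le_card hs).trans h

theorem faceNumber_zero {V : Type*} (Δ : PreAbstractSimplicialComplex V) :
    Δ.faceNumber 0 = 1 := by
  rw [faceNumber, Set.ncard_eq_one]
  refine ⟨∅, Set.ext fun s => ?_⟩
  simp only [Set.mem_ofPred_eq, Finset.card_eq_zero, Set.mem_singleton_iff, and_iff_right_iff_imp]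
  exact Or.inl

theorem faceNumber_twoSimplices {V : Type*} {A B : Finset V} (hAB : Disjoint A B) {k : ℕ}
    (hk : k ≠ 0) :
    (twoSimplices A B).faceNumber k = A.card.choose k + B.card.choose k := by
  classical
  have h : {s ∈ (twoSimplices A B).allFaces | s.card = k} =
      ((A.powersetCard k ∪ B.powersetCard k : Finset (Finset V)) : Set (Finset V)) := by
    ext s
    simp only [Set.mem_ofPred_eq, Finset.coe_union, Set.mem_union, Finset.mem_coe,
      Finset.mem_powersetCard, ← or_and_right, and_congr_left_iff]
    rintro rfl
    have hs : s.Nonempty := Finset.card_ne_zero.1 hk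
    constructor
    · rintro (rfl | ⟨-, h⟩)
      · simp at hk
      · exact h
    · exact fun h => Or.inr ⟨hs, h⟩
  rw [faceNumber, h, Set.ncard_coe_finset, Finset.card_union_of_disjoint,
    Finset.card_powersetCard, Finset.card_powersetCard]
  rw [Finset.disjoint_left]
  intro s hs hs'
  rw [Finset.mem_powersetCard] at hs hs'
  have : s = ∅ := Finset.subset_empty.1 (hAB hs.1 hs'.1)
  exact hk (by rw [← hs.2, this, Finset.card_empty])

end PreAbstractSimplicialComplex

open PreAbstractSimplicialComplex

/-- A linear functional that vanishes on the `h`-polynomials of all complexes of dimension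
`d - 1` vanishes on all polynomials of degree at most `d`. -/
theorem map_X_pow_eq_zero_of_map_hPoly_eq_zero {d : ℕ} (φ : ℝ[X] →ₗ[ℝ] ℝ)
    (hφ : ∀ (V : Type) [Finite V] (Δ : PreAbstractSimplicialComplex V), Δ.HasDimPred d →
      φ (Δ.hPoly d) = 0) {n : ℕ} (hn : n ≤ d) : φ (X ^ n) = 0 := by
  -- The empty face is split off because the two simplices share it.
  have hsum : ∀ i ≤ d, φ ((X - 1) ^ d) + ∑ k ∈ Finset.range d,
      ((d.choose (k + 1) : ℝ) + (i.choose (k + 1) : ℝ)) * φ ((X - 1) ^ (d - (k + 1))) = 0 := by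
    intro i hi
    let A : Finset (Fin d ⊕ Fin i) := Finset.univ.map Function.Embedding.inl
    let B : Finset (Fin d ⊕ Fin i) := Finset.univ.map Function.Embedding.inr
    have hA : A.card = d := by simp [A]
    have hB : B.card = i := by simp [B]
    have hAB : Disjoint A B := Finset.disjoint_map_inl_map_inr _ _
    have h := hφ _ (twoSimplices A B)
      (by simpa only [hA] using hasDimPred_twoSimplices (hB.trans_le (hi.trans_eq hA.symm)))
    rw [hPoly_eq_sum, Finset.sum_range_succ', faceNumber_zero, map_add, map_sum, add_comm] at h
    rw [← h]
    congr 1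
    · simp
    · refine Finset.sum_congr rfl fun k _ => ?_
      rw [faceNumber_twoSimplices hAB (Nat.succ_ne_zero k), hA, hB, ← C_eq_natCast, C_mul',
        map_smul, smul_eq_mul]
      push_cast
      rfl
  -- Subtracting the equation for 0 from that for i+1 leaves the coefficients C(i+1,k+1): a
  -- unitriangular system.
  have hpos : ∀ i < d, φ ((X - 1) ^ (d - (i + 1))) = 0 := by
    intro i
    induction i using Nat.strong_induction_on with
    | _ i ih =>
      intro hi
      have h := hsum (i + 1) hi
      have h0 := hsum 0 (Nat.zero_le d)
      simp only [add_mul, Finset.sum_add_distrib, Nat.choose_zero_succ, Nat.cast_zero, add_zero] at h h0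
      rw [← add_assoc, h0, zero_add, Finset.sum_eq_single i] at h
      · simpa using h
      · intro k hk hki
        rcases lt_or_gt_of_ne hki with hlt | hlt
        · rw [ih k hlt (Finset.mem_range.1 hk), mul_zero]
        · rw [Nat.choose_eq_zero_of_lt (by omega), Nat.cast_zero, zero_mul]
      · intro h'
        exact absurd (Finset.mem_range.2 hi) h'
  have hall : ∀ k ≤ d, φ ((X - 1) ^ k) = 0 := by
    intro k hk
    rcases hk.lt_or_eq with hk | rfl
    · have := hpos (d - 1 - k) (by omega)
      rwa [show d - (d - 1 - k + 1) = k by omega] at this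
    · have h0 := hsum 0 (Nat.zero_le k)
      rwa [Finset.sum_eq_zero (fun i hi => by rw [hpos i (Finset.mem_range.1 hi), mul_zero]),
        add_zero] at h0
  have hX : (X : ℝ[X]) ^ n = ∑ k ∈ Finset.range (n + 1), (n.choose k : ℝ) • (X - 1) ^ k := by
    conv_lhs => rw [← sub_add_cancel (X : ℝ[X]) 1, add_pow]
    refine Finset.sum_congr rfl fun k _ => ?_
    rw [one_pow, mul_one, mul_comm, ← C_eq_natCast, C_mul']
  rw [hX, map_sum]
  refine Finset.sum_eq_zero fun k hk => ?_
  have := Finset.mem_range.1 hk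
  rw [map_smul, hall k (by omega), smul_zero]

theorem IsBarycentricHMatrix.unique {d : ℕ} {H H' : Matrix (Fin (d + 1)) (Fin (d + 1)) ℝ}
    (hH : IsBarycentricHMatrix d H) (hH' : IsBarycentricHMatrix d H') : H = H' := by
  ext i j
  -- Row `i` of `H - H'`, read as a functional on h-polynomials.
  let φ : ℝ[X] →ₗ[ℝ] ℝ := ∑ m : Fin (d + 1), (H i m - H' i m) • lcoeff ℝ (d - m)
  have hφ : ∀ (V : Type) [Finite V] (Δ : PreAbstractSimplicialComplex V), Δ.HasDimPred d →
      φ (Δ.hPoly d) = 0 := by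
    intro V _ Δ hΔ
    have h := congrFun ((hH V Δ hΔ).symm.trans (hH' V Δ hΔ)) i
    rw [Matrix.mulVec, Matrix.mulVec, dotProduct, dotProduct, ← sub_eq_zero,
      ← Finset.sum_sub_distrib] at h
    rw [← h]
    simp [φ, hVector, sub_mul]
  have h := map_X_pow_eq_zero_of_map_hPoly_eq_zero φ hφ (Nat.sub_le d j)
  have hj := j.2
  have h2 : φ (X ^ (d - (j : ℕ))) = H i j - H' i j := by
    simp only [φ, LinearMap.sum_apply, LinearMap.smul_apply, lcoeff_apply, smul_eq_mul]
    rw [Finset.sum_eq_single j]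
    · rw [coeff_X_pow, if_pos rfl, mul_one]
    · intro m _ hm
      have := m.2
      have : (m : ℕ) ≠ j := fun h => hm (Fin.ext h)
      rw [coeff_X_pow, if_neg (by omega), mul_zero]
    · simp
  exact sub_eq_zero.1 (h2.symm.trans h)

theorem mainTheorem1 (d : ℕ) :
    (∃! H : Matrix (Fin (d + 1)) (Fin (d + 1)) ℝ, IsBarycentricHMatrix d H) ∧
    ∀ H : Matrix (Fin (d + 1)) (Fin (d + 1)) ℝ, IsBarycentricHMatrix d H →
      (∀ i j : Fin (d + 1), H i j = (refinedEulerian (d + 1) i j : ℝ)) ∧ H.IsTP 2 := by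
  have h0 := isBarycentricHMatrix_refinedEulerian d
  refine ⟨⟨_, h0, fun H hH => hH.unique h0⟩, fun H hH => ?_⟩
  rw [hH.unique h0]
  exact ⟨fun _ _ => rfl, isTP_two_refinedEulerian d⟩
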